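/- For $M\in\mathbb{R}^{n\times k}$ let $\mathcal{Q}(M)$ be its qualitative class, i.e. the set of all matrices in $\mathbb{R}^{n\times k}$ with the same sign pattern $(+,-,0)$ as $M$, and let $\mathcal{Q}_0(M)$ be the closure of $\mathcal{Q}(M)$. For $A\in\mathbb{R}^{n\times k}$ and $B\in\mathbb{R}^{k\times n}$ the DSR graph $G_{A,B}$ is the following signed, labelled bipartite graph with directed and undirected edges. Its vertices are $S_1,\dots,S_n,R_1,\dots,R_k$. There is an arc $R_jS_i$ with the sign of $A_{ij}$ if and only if $A_{ij}\neq0$, and an arc $S_iR_j$ with the sign of $B_{ji}$ if and only if $B_{ji}\neq 0$; a pair of antiparallel arcs of the same sign is treated as a single undirected edge. An edge $e$ that is undirected or directed from $R_j$ to $S_i$ has the label $l(e)=|A_{ij}|$; an edge directed only from an S-vertex to an R-vertex has the label $l(e)=\infty$. A cycle is a nonempty closed walk which respects the directions of the edges and repeats no vertex (except that the first and last vertices agree) and no edge. A cycle $W=(e_1,\dots,e_{2r})$, of length $|W|=2r$, is an e-cycle if $(-1)^{|W|/2}\,\mathrm{sign}(W)=1$ and an o-cycle if $(-1)^{|W|/2}\,\mathrm{sign}(W)=-1$,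 where $\mathrm{sign}(W)$ is the product of the signs of its edges. It is an s-cycle if all its labels are finite and $\prod_{i=1}^r l(e_{2i-1})=\prod_{i=1}^r l(e_{2i})$. **Statement.** Let $C\in\mathbb{R}^{m\times3}$ and let $A\in\mathbb{R}^{m\times 3}$, $B\in\mathbb{R}^{3\times m}$ be such that $A,B^t\in\mathcal{Q}_0(C)$. If $G_{A,B}$ satisfies (i) all e-cycles of length $4$ are s-cycles, and (ii) all o-cycles of length $6$ are s-cycles, then the nonreal spectrum of $AB$ does not intersect the open left half-plane, i.e. every nonreal eigenvalue $\lambda\in\mathbb{C}$ of $AB$ satisfies $\operatorname{Re}\lambda\geq0$. -/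

import Mathlib

open scoped ENNReal Matrix

/-! ### Qualitative classes -/

/-- The qualitative class of `M`: all real matrices with the same sign pattern as `M`. -/
def qualClass {ι κ : Type*} (M : Matrix ι κ ℝ) : Set (Matrix ι κ ℝ) :=
  {X | ∀ i j, (0 < M i j → 0 < X i j) ∧ (M i j < 0 → X i j < 0) ∧ (M i j = 0 → X i j = 0)}

/-- The topological closure of the qualitative class of `M`
(for the entrywise topology on real matrices). -/
def qualClass₀ {ι κ : Type*} (M : Matrix ι κ ℝ) : Set (Matrix ι κ ℝ) :=
  closure (qualClass M)

/-! ### The DSR graph of a pair of matrices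

The vertices are `Sum.inl i` (the S-vertex of row `i` of `A`) and `Sum.inr j` (the R-vertex of
column `j` of `A`). An entry `A i j ≠ 0` gives an arc from R-vertex `j` to S-vertex `i`, an entry
`B j i ≠ 0` gives an arc from S-vertex `i` to R-vertex `j`; an antiparallel pair of arcs of the
same sign is merged into a single undirected edge. -/

/-- The three possible orientations of an edge of a DSR graph. -/
inductive DSROrientation : Type
  | undirected
  | rToS
  | sToR

/-- Existence of an edge with a given orientation between S-vertex `i` and R-vertex `j`.
An undirected edge exists if both arcs exist and have the same sign. An arc with only
R-to-S (S-to-R) orientation exists if the relevant entry is nonzero and the arc has not been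
merged with an opposite arc of the same sign. -/
def DSREdgeExists {ι κ : Type*} (A : Matrix ι κ ℝ) (B : Matrix κ ι ℝ) (i : ι) (j : κ) :
    DSROrientation → Prop
  | .undirected => A i j ≠ 0 ∧ B j i ≠ 0 ∧ SignType.sign (A i j) = SignType.sign (B j i)
  | .rToS => A i j ≠ 0 ∧ SignType.sign (A i j) ≠ SignType.sign (B j i)
  | .sToR => B j i ≠ 0 ∧ SignType.sign (A i j) ≠ SignType.sign (B j i)

/-- The edges of the DSR graph `G_{A,B}`. -/
structure DSREdge {ι κ : Type*} (A : Matrix ι κ ℝ) (B : Matrix κ ι ℝ) where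
  /-- the S-vertex of the edge -/
  s : ι
  /-- the R-vertex of the edge -/
  r : κ
  /-- the orientation of the edge -/
  orient : DSROrientation
  /-- the edge is present in the graph -/
  edge_exists : DSREdgeExists A B s r orient

namespace DSREdge

variable {ι κ : Type*} {A : Matrix ι κ ℝ} {B : Matrix κ ι ℝ}

/-- The sign of an edge: the sign of the entry of `A`, or of the entry of `B` if the edge
comes only from `B`. -/
noncomputable def sgn (e : DSREdge A B) : ℤ :=
  match e.orient with
  | .undirected => (SignType.sign (A e.s e.r) : ℤ)
  | .rToS => (SignType.sign (A e.s e.r) : ℤ)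
  | .sToR => (SignType.sign (B e.r e.s) : ℤ)

/-- The label of an edge: the modulus of the entry of `A`, or `∞` if the edge has only S-to-R
orientation. -/
noncomputable def label (e : DSREdge A B) : ℝ≥0∞ :=
  match e.orient with
  | .undirected => ENNReal.ofReal |A e.s e.r|
  | .rToS => ENNReal.ofReal |A e.s e.r|
  | .sToR => ∞

/-- The edge `e` can be traversed from the vertex `u` to the vertex `v`. -/
def Traverses (e : DSREdge A B) (u v : ι ⊕ κ) : Prop :=
  (u = Sum.inl e.s ∧ v = Sum.inr e.r ∧ e.orient ≠ .rToS) ∨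
  (u = Sum.inr e.r ∧ v = Sum.inl e.s ∧ e.orient ≠ .sToR)

end DSREdge

/-- A closed walk of length `k` in the DSR graph `G_{A,B}`: vertices `v₀, …, v_k` with
`v₀ = v_k` and edges `e₀, …, e_{k-1}` such that `e_i` leads from `v_i` to `v_{i+1}`. -/
structure DSRClosedWalk {ι κ : Type*} (A : Matrix ι κ ℝ) (B : Matrix κ ι ℝ) (k : ℕ) where
  /-- the vertices of the walk -/
  vert : Fin (k + 1) → ι ⊕ κ
  /-- the edges of the walk -/
  edge : Fin k → DSREdge A B
  /-- each edge leads from its preceding vertex to its following vertex -/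
  step : ∀ i : Fin k, (edge i).Traverses (vert i.castSucc) (vert i.succ)
  /-- the first and the last vertex agree -/
  closed : vert 0 = vert (Fin.last k)

namespace DSRClosedWalk

variable {ι κ : Type*} {A : Matrix ι κ ℝ} {B : Matrix κ ι ℝ} {k : ℕ}

/-- A cycle: a nonempty closed walk without repeated vertices (other than first = last) and
without repeated edges. The latter only excludes walking back and forth along a single
undirected edge, which does not count as a cycle of length two. -/
def IsCycle (W : DSRClosedWalk A B k) : Prop :=
  0 < k ∧ Function.Injective (fun i : Fin k => W.vert i.castSucc) ∧ Function.Injective W.edge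

/-- The sign of a closed walk: the product of the signs of its edges. -/
noncomputable def sgn (W : DSRClosedWalk A B k) : ℤ := ∏ i, (W.edge i).sgn

/-- The parity `(-1)^(|W|/2) sign(W)`; the length of a closed walk is even. -/
noncomputable def parity (W : DSRClosedWalk A B k) : ℤ := (-1) ^ (k / 2) * W.sgn

/-- An e-cycle: a cycle of parity `1`. -/
def IsECycle (W : DSRClosedWalk A B k) : Prop := W.IsCycle ∧ W.parity = 1

/-- An o-cycle: a cycle of parity `-1`. -/
def IsOCycle (W : DSRClosedWalk A B k) : Prop := W.IsCycle ∧ W.parity = -1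

/-- A closed s-walk: all labels are finite, and the product of the labels of every other edge
equals the product of the labels of the remaining edges. -/
def IsSWalk (W : DSRClosedWalk A B k) : Prop :=
  (∀ i, (W.edge i).label ≠ ∞) ∧
  ∏ i : Fin k with Even i.val, (W.edge i).label = ∏ i : Fin k with Odd i.val, (W.edge i).label

/-- An s-cycle: a cycle that is an s-walk. -/
def IsSCycle (W : DSRClosedWalk A B k) : Prop := W.IsCycle ∧ W.IsSWalk

end DSRClosedWalk

/-! ### Spectra -/

/-- The nonreal spectrum of a real square matrix: its nonreal complex eigenvalues. -/
def nonrealSpectrum {ι : Type*} [Fintype ι] [DecidableEq ι] (M : Matrix ι ι ℝ) : Set ℂ :=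
  {z | z ∈ spectrum ℂ (M.map Complex.ofReal) ∧ z.im ≠ 0}

/-- The open left half-plane of `ℂ`. -/
def openLeftHalfPlane : Set ℂ := {z | z.re < 0}

/-! Nonzero eigenvalues of `A * B` are eigenvalues of the 3×3 matrix M = `B * A`. With c₁, c₂, c₃
its trace, sum of principal 2-minors and determinant, c₁c₂ - c₃ is the product of the pairwise sums
of its eigenvalues. For a conjugate pair z, z̄ and third root w this is 2 Re z · |z + w|², so it
suffices that c₁c₂ - c₃ ≥ 0. Moreover c₁c₂ - c₃ = det(c₁I - Mᵀ), and c₁I - Mᵀ factors through the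
matrices whose rows are cross products of the rows of `A` and `Bᵀ` with the basis vectors. By
Cauchy–Binet (`factorial_mul_det_mul`) it is a positive multiple of a sum of products of
corresponding 3-minors. Each minor is zero, an entry times a 2-minor, or a difference of two cubic
monomials. Conditions (i) and (ii) make the products nonnegative (`minor_two_mul_nonneg`,
`hexagon_mul_nonneg`). -/

theorem mul_nonneg_of_mem_qualClass₀ {ι κ : Type*} {C A : Matrix ι κ ℝ} {B : Matrix κ ι ℝ}
    (hA : A ∈ qualClass₀ C) (hB : Bᵀ ∈ qualClass₀ C) (i : ι) (j : κ) : 0 ≤ A i j * B j i := by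
  have key : ∀ X ∈ qualClass₀ C, (0 ≤ C i j → 0 ≤ X i j) ∧ (C i j ≤ 0 → X i j ≤ 0) := by
    intro X hX
    -- Only the weak sign conditions survive passage to the closure.
    have hc : IsClosed {X : Matrix ι κ ℝ |
        (0 ≤ C i j → 0 ≤ X i j) ∧ (C i j ≤ 0 → X i j ≤ 0)} := by
      have hcont : Continuous fun X : Matrix ι κ ℝ => X i j := by fun_prop
      refine IsClosed.and ?_ ?_
      · exact isClosed_imp isOpen_const (isClosed_le continuous_const hcont)
      · exact isClosed_imp isOpen_const (isClosed_le hcont continuous_const)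
    refine closure_minimal ?_ hc hX
    intro Y hY
    obtain ⟨h1, h2, h3⟩ := hY i j
    refine ⟨fun h => ?_, fun h => ?_⟩
    · rcases h.eq_or_lt with h | h
      · exact (h3 h.symm).ge
      · exact (h1 h).le
    · rcases h.eq_or_lt with h | h
      · exact (h3 h).le
      · exact (h2 h).le
  obtain ⟨a1, a2⟩ := key A hA
  obtain ⟨b1, b2⟩ := key _ hB
  rcases le_total 0 (C i j) with h | h
  · exact mul_nonneg (a1 h) (b1 h)
  · exact mul_nonneg_of_nonpos_of_nonpos (a2 h) (b2 h)

/-! ### From cycle conditions to signs of products of minors -/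

namespace DSREdge

variable {ι κ : Type*} {A : Matrix ι κ ℝ} {B : Matrix κ ι ℝ}

theorem exists_of_left_ne_zero {i : ι} {j : κ} (h : A i j ≠ 0) :
    ∃ e : DSREdge A B, e.s = i ∧ e.r = j ∧ e.orient ≠ .sToR ∧
      e.sgn = (SignType.sign (A i j) : ℤ) ∧ e.label = ENNReal.ofReal |A i j| := by
  by_cases hs : SignType.sign (A i j) = SignType.sign (B j i)
  · have hb : B j i ≠ 0 := by
      rw [← sign_ne_zero, ← hs, sign_ne_zero]
      exact h
    exact ⟨⟨i, j, .undirected, h, hb, hs⟩, rfl, rfl, by simp, rfl, rfl⟩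
  · exact ⟨⟨i, j, .rToS, h, hs⟩, rfl, rfl, by simp, rfl, rfl⟩

/-- A finite label forces the edge to be undirected; this is how an s-cycle gives information on the
signs of `A` along arcs coming from `B`. -/
theorem exists_of_right_ne_zero {i : ι} {j : κ} (h : B j i ≠ 0) :
    ∃ e : DSREdge A B, e.s = i ∧ e.r = j ∧ e.orient ≠ .rToS ∧
      e.sgn = (SignType.sign (B j i) : ℤ) ∧
      (e.label ≠ ∞ → SignType.sign (A i j) = SignType.sign (B j i) ∧
        e.label = ENNReal.ofReal |A i j|) := by
  by_cases hs : SignType.sign (A i j) = SignType.sign (B j i)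
  · have ha : A i j ≠ 0 := by
      rw [← sign_ne_zero, hs, sign_ne_zero]
      exact h
    exact ⟨⟨i, j, .undirected, ha, h, hs⟩, rfl, rfl, by simp, by simp [sgn, hs],
      fun _ => ⟨hs, rfl⟩⟩
  · exact ⟨⟨i, j, .sToR, h, hs⟩, rfl, rfl, by simp, rfl, fun h => absurd rfl h⟩

end DSREdge

theorem eq_of_abs_eq_of_mul_pos {x y : ℝ} (h : |x| = |y|) (hxy : 0 < x * y) : x = y := by
  rcases abs_eq_abs.1 h with h | h
  · exact h
  · rw [h] at hxy
    nlinarith [mul_self_nonneg y]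

section Cycles

variable {ι κ : Type*} {A : Matrix ι κ ℝ} {B : Matrix κ ι ℝ}

/-- The four factors of `hpos` are the arcs of a 4-cycle of positive sign, hence an e-cycle. The
label condition gives equality of absolute values, and finite labels transfer the signs from `B` to
`A`. -/
theorem mul_eq_mul_of_fourCycle
    (h4 : ∀ W : DSRClosedWalk A B 4, W.IsECycle → W.IsSCycle)
    {i₁ i₂ : ι} {j₁ j₂ : κ} (hi : i₁ ≠ i₂) (hj : j₁ ≠ j₂)
    (hpos : 0 < (A i₁ j₁ * A i₂ j₂) * (B j₂ i₁ * B j₁ i₂)) :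
    A i₁ j₁ * A i₂ j₂ = A i₁ j₂ * A i₂ j₁ := by
  have hne := hpos.ne'
  simp only [mul_ne_zero_iff] at hne
  obtain ⟨⟨ha, hd⟩, hb, hc⟩ := hne
  obtain ⟨e₀, s₀, r₀, o₀, g₀, l₀⟩ := DSREdge.exists_of_left_ne_zero (B := B) ha
  obtain ⟨e₁, s₁, r₁, o₁, g₁, l₁⟩ := DSREdge.exists_of_right_ne_zero (A := A) hb
  obtain ⟨e₂, s₂, r₂, o₂, g₂, l₂⟩ := DSREdge.exists_of_left_ne_zero (B := B) hd
  obtain ⟨e₃, s₃, r₃, o₃, g₃, l₃⟩ := DSREdge.exists_of_right_ne_zero (A := A) hc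
  let W : DSRClosedWalk A B 4 :=
    { vert := ![.inr j₁, .inl i₁, .inr j₂, .inl i₂, .inr j₁]
      edge := ![e₀, e₁, e₂, e₃]
      step := by
        intro k
        fin_cases k
        · exact .inr ⟨by simp [r₀], by simp [s₀], o₀⟩
        · exact .inl ⟨by simp [s₁], by simp [r₁], o₁⟩
        · exact .inr ⟨by simp [r₂], by simp [s₂], o₂⟩
        · exact .inl ⟨by simp [s₃], by simp [r₃], o₃⟩
      closed := rfl }
  have hW : W.IsECycle := by
    refine ⟨⟨by norm_num, ?_, ?_⟩, ?_⟩
    · intro k l hkl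
      fin_cases k <;> fin_cases l <;> simp_all [W, eq_comm]
    · refine Function.Injective.of_comp (f := fun e : DSREdge A B => (e.s, e.r)) ?_
      intro k l hkl
      fin_cases k <;> fin_cases l <;> simp_all [W, eq_comm]
    · have := sign_pos hpos
      simp only [sign_mul] at this
      simp only [DSRClosedWalk.parity, DSRClosedWalk.sgn, Fin.prod_univ_four, W,
        Matrix.cons_val, g₀, g₁, g₂, g₃]
      norm_cast
      rw [show ∀ a b c d : SignType, a * b * c * d = a * c * (b * d) by decide, this]
      rfl
  obtain ⟨-, hfin, hprod⟩ := h4 W hW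
  obtain ⟨t₁, l₁⟩ := l₁ (hfin 1)
  obtain ⟨t₃, l₃⟩ := l₃ (hfin 3)
  have hprod' : e₀.label * e₂.label = e₁.label * e₃.label := by
    simpa [Finset.prod_filter, Fin.prod_univ_four, W, Nat.even_iff, Nat.odd_iff] using hprod
  rw [l₀, l₁, l₂, l₃, ← ENNReal.ofReal_mul (abs_nonneg _), ← ENNReal.ofReal_mul (abs_nonneg _),
    ENNReal.ofReal_eq_ofReal_iff (by positivity) (by positivity), ← abs_mul, ← abs_mul] at hprod'
  refine eq_of_abs_eq_of_mul_pos hprod' ?_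
  rw [← sign_eq_one_iff, sign_mul, sign_mul (A i₁ j₂), t₁, t₃, ← sign_mul, ← sign_mul,
    sign_eq_one_iff]
  exact hpos

/-- As for length 4, but (-1)³ turns positive sign into an o-cycle. -/
theorem mul_eq_mul_of_sixCycle
    (h6 : ∀ W : DSRClosedWalk A B 6, W.IsOCycle → W.IsSCycle)
    {i₁ i₂ i₃ : ι} {j₁ j₂ j₃ : κ} (hi₁₂ : i₁ ≠ i₂) (hi₁₃ : i₁ ≠ i₃) (hi₂₃ : i₂ ≠ i₃)
    (hj₁₂ : j₁ ≠ j₂) (hj₁₃ : j₁ ≠ j₃) (hj₂₃ : j₂ ≠ j₃)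
    (hpos : 0 < (A i₁ j₁ * A i₂ j₂ * A i₃ j₃) * (B j₂ i₁ * B j₃ i₂ * B j₁ i₃)) :
    A i₁ j₁ * A i₂ j₂ * A i₃ j₃ = A i₁ j₂ * A i₂ j₃ * A i₃ j₁ := by
  have hne := hpos.ne'
  simp only [mul_ne_zero_iff] at hne
  obtain ⟨⟨⟨ha₁, ha₂⟩, ha₃⟩, ⟨hb₁, hb₂⟩, hb₃⟩ := hne
  obtain ⟨e₀, s₀, r₀, o₀, g₀, l₀⟩ := DSREdge.exists_of_left_ne_zero (B := B) ha₁
  obtain ⟨e₁, s₁, r₁, o₁, g₁, l₁⟩ := DSREdge.exists_of_right_ne_zero (A := A) hb₁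
  obtain ⟨e₂, s₂, r₂, o₂, g₂, l₂⟩ := DSREdge.exists_of_left_ne_zero (B := B) ha₂
  obtain ⟨e₃, s₃, r₃, o₃, g₃, l₃⟩ := DSREdge.exists_of_right_ne_zero (A := A) hb₂
  obtain ⟨e₄, s₄, r₄, o₄, g₄, l₄⟩ := DSREdge.exists_of_left_ne_zero (B := B) ha₃
  obtain ⟨e₅, s₅, r₅, o₅, g₅, l₅⟩ := DSREdge.exists_of_right_ne_zero (A := A) hb₃
  let W : DSRClosedWalk A B 6 :=
    { vert := ![.inr j₁, .inl i₁, .inr j₂, .inl i₂, .inr j₃, .inl i₃, .inr j₁]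
      edge := ![e₀, e₁, e₂, e₃, e₄, e₅]
      step := by
        intro k
        fin_cases k
        · exact .inr ⟨by simp [r₀], by simp [s₀], o₀⟩
        · exact .inl ⟨by simp [s₁], by simp [r₁], o₁⟩
        · exact .inr ⟨by simp [r₂], by simp [s₂], o₂⟩
        · exact .inl ⟨by simp [s₃], by simp [r₃], o₃⟩
        · exact .inr ⟨by simp [r₄], by simp [s₄], o₄⟩
        · exact .inl ⟨by simp [s₅], by simp [r₅], o₅⟩
      closed := rfl }
  have hW : W.IsOCycle := by
    refine ⟨⟨by norm_num, ?_, ?_⟩, ?_⟩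
    · intro k l hkl
      fin_cases k <;> fin_cases l <;>
        simp [W, hi₁₂, hi₁₃, hi₂₃, hj₁₂, hj₁₃, hj₂₃, hi₁₂.symm, hi₁₃.symm, hi₂₃.symm,
          hj₁₂.symm, hj₁₃.symm, hj₂₃.symm] at hkl ⊢
    · refine Function.Injective.of_comp (f := fun e : DSREdge A B => (e.s, e.r)) ?_
      intro k l hkl
      fin_cases k <;> fin_cases l <;>
        simp [W, s₀, s₁, s₂, s₃, s₄, s₅, r₀, r₁, r₂, r₃, r₄, r₅,
          hi₁₂, hi₁₃, hi₂₃, hj₁₂, hj₁₃, hj₂₃, hi₁₂.symm, hi₁₃.symm, hi₂₃.symm,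
          hj₁₂.symm, hj₁₃.symm, hj₂₃.symm] at hkl ⊢
    · have := sign_pos hpos
      simp only [sign_mul] at this
      simp only [DSRClosedWalk.parity, DSRClosedWalk.sgn, Fin.prod_univ_six, W,
        Matrix.cons_val, g₀, g₁, g₂, g₃, g₄, g₅]
      norm_cast
      rw [show ∀ a b c d e f : SignType, a * b * c * d * e * f = a * c * e * (b * d * f) by
        intros; ac_rfl, this]
      rfl
  obtain ⟨-, hfin, hprod⟩ := h6 W hW
  obtain ⟨t₁, l₁⟩ := l₁ (hfin 1)
  obtain ⟨t₃, l₃⟩ := l₃ (hfin 3)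
  obtain ⟨t₅, l₅⟩ := l₅ (hfin 5)
  have hprod' : e₀.label * e₂.label * e₄.label = e₁.label * e₃.label * e₅.label := by
    simpa [Finset.prod_filter, Fin.prod_univ_six, W, Nat.even_iff, Nat.odd_iff] using hprod
  rw [l₀, l₁, l₂, l₃, l₄, l₅, ← ENNReal.ofReal_mul (by positivity),
    ← ENNReal.ofReal_mul (by positivity), ← ENNReal.ofReal_mul (by positivity),
    ← ENNReal.ofReal_mul (by positivity),
    ENNReal.ofReal_eq_ofReal_iff (by positivity) (by positivity), ← abs_mul, ← abs_mul,
    ← abs_mul, ← abs_mul] at hprod'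
  refine eq_of_abs_eq_of_mul_pos hprod' ?_
  rw [← sign_eq_one_iff, sign_mul, sign_mul (A i₁ j₂ * _), sign_mul (A i₁ j₂), t₁, t₃, t₅,
    ← sign_mul, ← sign_mul, ← sign_mul, sign_eq_one_iff]
  exact hpos

/-- The diagonal terms pp', qq' are harmless; a mixed term of the bad sign comes from a cycle and
forces p = q. -/
theorem sub_mul_sub_nonneg {p q p' q' : ℝ} (hp : 0 ≤ p * p') (hq : 0 ≤ q * q')
    (h : 0 < p * q' → p = q) (h' : 0 < q * p' → p = q) : 0 ≤ (p - q) * (p' - q') := by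
  by_cases hpq : p = q
  · simp [hpq]
  · have h1 := not_lt.1 (mt h hpq)
    have h2 := not_lt.1 (mt h' hpq)
    linarith

theorem minor_two_mul_nonneg (hAB : ∀ i j, 0 ≤ A i j * B j i)
    (h4 : ∀ W : DSRClosedWalk A B 4, W.IsECycle → W.IsSCycle) (i₁ i₂ : ι) (j₁ j₂ : κ) :
    0 ≤ (A i₁ j₁ * A i₂ j₂ - A i₁ j₂ * A i₂ j₁) *
      (B j₁ i₁ * B j₂ i₂ - B j₂ i₁ * B j₁ i₂) := by
  rcases eq_or_ne i₁ i₂ with rfl | hi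
  · refine le_of_eq ?_
    ring
  rcases eq_or_ne j₁ j₂ with rfl | hj
  · refine le_of_eq ?_
    ring
  apply sub_mul_sub_nonneg
  · linarith [mul_nonneg (hAB i₁ j₁) (hAB i₂ j₂)]
  · linarith [mul_nonneg (hAB i₁ j₂) (hAB i₂ j₁)]
  · exact fun h => mul_eq_mul_of_fourCycle h4 hi hj h
  · exact fun h => (mul_eq_mul_of_fourCycle h4 hi hj.symm h).symm

theorem hexagon_mul_nonneg (hAB : ∀ i j, 0 ≤ A i j * B j i)
    (h4 : ∀ W : DSRClosedWalk A B 4, W.IsECycle → W.IsSCycle)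
    (h6 : ∀ W : DSRClosedWalk A B 6, W.IsOCycle → W.IsSCycle) (i₁ i₂ i₃ : ι) {j₁ j₂ j₃ : κ}
    (hj₁₂ : j₁ ≠ j₂) (hj₁₃ : j₁ ≠ j₃) (hj₂₃ : j₂ ≠ j₃) :
    0 ≤ (A i₁ j₁ * A i₂ j₂ * A i₃ j₃ - A i₁ j₂ * A i₂ j₃ * A i₃ j₁) *
      (B j₁ i₁ * B j₂ i₂ * B j₃ i₃ - B j₂ i₁ * B j₃ i₂ * B j₁ i₃) := by
  -- When two rows coincide, the binomial is an entry times a 2-minor.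
  rcases eq_or_ne i₁ i₂ with rfl | hi₁₂
  · linarith [mul_nonneg (hAB i₁ j₂) (minor_two_mul_nonneg hAB h4 i₁ i₃ j₁ j₃)]
  rcases eq_or_ne i₁ i₃ with rfl | hi₁₃
  · linarith [mul_nonneg (hAB i₁ j₁) (minor_two_mul_nonneg hAB h4 i₁ i₂ j₂ j₃)]
  rcases eq_or_ne i₂ i₃ with rfl | hi₂₃
  · linarith [mul_nonneg (hAB i₂ j₃) (minor_two_mul_nonneg hAB h4 i₁ i₂ j₁ j₂)]
  apply sub_mul_sub_nonneg
  · linarith [mul_nonneg (mul_nonneg (hAB i₁ j₁) (hAB i₂ j₂)) (hAB i₃ j₃)]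
  · linarith [mul_nonneg (mul_nonneg (hAB i₁ j₂) (hAB i₂ j₃)) (hAB i₃ j₁)]
  · exact fun h => mul_eq_mul_of_sixCycle h6 hi₁₂ hi₁₃ hi₂₃ hj₁₂ hj₁₃ hj₂₃ h
  · intro h
    -- The other mixed term is the same hexagon traversed in the opposite direction.
    have := mul_eq_mul_of_sixCycle h6 (i₁ := i₁) (i₂ := i₃) (i₃ := i₂) (j₁ := j₂) (j₂ := j₁)
      (j₃ := j₃) hi₁₃ hi₁₂ hi₂₃.symm hj₁₂.symm hj₂₃ hj₁₃ (by linarith)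
    linarith

end Cycles

/-! ### Cauchy–Binet, cross products and the cubic characteristic polynomial -/

namespace Matrix

theorem det_mul_eq_sum_prod_mul_det {n p R : Type*} [Fintype n] [DecidableEq n] [Fintype p]
    [CommRing R] (X : Matrix n p R) (Y : Matrix p n R) :
    (X * Y).det = ∑ f : n → p, (∏ i, X i (f i)) * (Y.submatrix f id).det := by
  have hrow : X * Y = fun i => ∑ q, X i q • Y q := by
    ext i j
    simp [mul_apply, Finset.sum_apply]
  have := (detRowAlternating (R := R) (n := n)).toMultilinearMap.map_sum
    (fun i q => X i q • Y q)
  rw [hrow]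
  refine this.trans (Finset.sum_congr rfl fun f _ => ?_)
  exact (detRowAlternating (R := R) (n := n)).toMultilinearMap.map_smul_univ
    (fun i => X i (f i)) (fun i => Y (f i))

/-- The Cauchy–Binet formula, summed over all (not only increasing) choices of indices. -/
theorem factorial_mul_det_mul {n p R : Type*} [Fintype n] [DecidableEq n] [Fintype p]
    [CommRing R] (X : Matrix n p R) (Y : Matrix p n R) :
    ((Fintype.card n).factorial : R) * (X * Y).det =
      ∑ f : n → p, (X.submatrix id f).det * (Y.submatrix f id).det := by
  -- Expanding the minor of `X` by the Leibniz formula, each permutation contributes one full copy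
  -- of the determinant, whence the factorial.
  have hσ (σ : Equiv.Perm n) :
      ∑ f : n → p, ((Equiv.Perm.sign σ : ℤ) : R) * (∏ i, X (σ i) (f i)) *
        (Y.submatrix f id).det = (X * Y).det := by
    rw [det_mul_eq_sum_prod_mul_det, ← (Equiv.arrowCongr σ.symm (Equiv.refl p)).sum_comp]
    refine Finset.sum_congr rfl fun f _ => ?_
    have h1 : (Y.submatrix (Equiv.arrowCongr σ.symm (Equiv.refl p) f) id).det =
        ((Equiv.Perm.sign σ : ℤ) : R) * (Y.submatrix f id).det :=
      det_permute σ (Y.submatrix f id)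
    have h2 : ∏ i, X (σ i) (Equiv.arrowCongr σ.symm (Equiv.refl p) f i) = ∏ i, X i (f i) :=
      Equiv.prod_comp σ fun i => X i (f i)
    have h3 : ((Equiv.Perm.sign σ : ℤ) : R) * ((Equiv.Perm.sign σ : ℤ) : R) = 1 := by
      rw [← Int.cast_mul, ← Units.val_mul, Int.units_mul_self]
      simp
    rw [h1, h2]
    linear_combination (∏ i, X i (f i)) * (Y.submatrix f id).det * h3
  simp_rw [det_apply' (X.submatrix id _), Finset.sum_mul]
  rw [Finset.sum_comm]
  simp only [submatrix_apply, id, hσ, Finset.sum_const, nsmul_eq_mul, Finset.card_univ,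
    Fintype.card_perm]

/-- The matrices of the cross products with the rows of `A`, stacked on top of each other. -/
def crossRows {ι R : Type*} [CommRing R] (A : Matrix ι (Fin 3) R) :
    Matrix (ι × Fin 3) (Fin 3) R :=
  fun q => ![![0, A q.1 2, -A q.1 1], ![-A q.1 2, 0, A q.1 0], ![A q.1 1, -A q.1 0, 0]] q.2

theorem transpose_crossRows_mul_crossRows {ι R : Type*} [Fintype ι] [CommRing R]
    (A : Matrix ι (Fin 3) R) (B : Matrix (Fin 3) ι R) :
    (crossRows Bᵀ)ᵀ * crossRows A = (B * A).trace • (1 : Matrix (Fin 3) (Fin 3) R) - (B * A)ᵀ := by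
  ext k l
  simp only [mul_apply, trace_fin_three, Fintype.sum_prod_type, Fin.sum_univ_three,
    ← Finset.sum_add_distrib, sub_apply, smul_apply, transpose_apply]
  fin_cases k <;> fin_cases l <;>
    simp [crossRows, ← Finset.sum_sub_distrib, ← Finset.sum_neg_distrib] <;>
    refine Finset.sum_congr rfl fun i _ => ?_ <;> ring

/-- The sum of the principal minors of order two. -/
def minorSum {R : Type*} [CommRing R] (M : Matrix (Fin 3) (Fin 3) R) : R :=
  M 0 0 * M 1 1 - M 0 1 * M 1 0 + (M 0 0 * M 2 2 - M 0 2 * M 2 0) +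
    (M 1 1 * M 2 2 - M 1 2 * M 2 1)

theorem det_trace_smul_one_sub_transpose {R : Type*} [CommRing R]
    (M : Matrix (Fin 3) (Fin 3) R) :
    (M.trace • (1 : Matrix (Fin 3) (Fin 3) R) - Mᵀ).det = M.trace * M.minorSum - M.det := by
  simp [det_fin_three, trace_fin_three, minorSum]
  ring

theorem det_smul_one_sub {R : Type*} [CommRing R] (M : Matrix (Fin 3) (Fin 3) R) (z : R) :
    (z • (1 : Matrix (Fin 3) (Fin 3) R) - M).det =
      z ^ 3 - M.trace * z ^ 2 + M.minorSum * z - M.det := by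
  simp [det_fin_three, trace_fin_three, minorSum]
  ring

theorem mem_spectrum_mul_swap {K ι κ : Type*} [Field K] [Fintype ι] [DecidableEq ι] [Fintype κ]
    [DecidableEq κ] (A : Matrix ι κ K) (B : Matrix κ ι K) {z : K} (hz : z ≠ 0)
    (h : z ∈ spectrum K (A * B)) : (z • (1 : Matrix κ κ K) - B * A).det = 0 := by
  rw [spectrum.mem_iff, isUnit_iff_isUnit_det, isUnit_iff_ne_zero, not_not,
    ← exists_mulVec_eq_zero_iff] at h
  obtain ⟨v, hv, hv0⟩ := h
  rw [sub_mulVec, sub_eq_zero, Algebra.algebraMap_eq_smul_one, smul_mulVec, one_mulVec] at hv0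
  rw [← exists_mulVec_eq_zero_iff]
  -- An eigenvector v of the product yields Bv, which is nonzero because z ≠ 0.
  refine ⟨B *ᵥ v, fun h0 => ?_, ?_⟩
  · rw [← mulVec_mulVec, h0, mulVec_zero] at hv0
    exact (smul_ne_zero hz hv) hv0
  · rw [sub_mulVec, smul_mulVec, one_mulVec, ← mulVec_smul, hv0]
    simp [mulVec_mulVec, Matrix.mul_assoc]

end Matrix

theorem re_nonneg_of_cubic_root {c₁ c₂ c₃ : ℝ} (hc : 0 ≤ c₁ * c₂ - c₃) {z : ℂ} (hz : z.im ≠ 0)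
    (h : z ^ 3 - c₁ * z ^ 2 + c₂ * z - c₃ = 0) : 0 ≤ z.re := by
  obtain ⟨x, y⟩ := z
  have hre := congrArg Complex.re h
  have him := congrArg Complex.im h
  simp [pow_succ] at hre him hz
  -- The imaginary part of the equation, divided by y ≠ 0.
  have h2 : c₂ = y ^ 2 - 3 * x ^ 2 + 2 * c₁ * x := by
    apply mul_left_cancel₀ hz
    linear_combination him
  -- The third root is c₁ - 2x, so the second factor is |z + w|².
  have h3 : c₁ * c₂ - c₃ = 2 * x * ((x - c₁) ^ 2 + y ^ 2) := by
    linear_combination hre + (c₁ - x) * h2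
  rw [h3] at hc
  have hy : 0 < (x - c₁) ^ 2 + y ^ 2 := by positivity
  have := nonneg_of_mul_nonneg_left hc hy
  simpa using this

/-! ### Nonnegativity of the Cauchy–Binet terms -/

section CrossRows

variable {ι : Type*} {A : Matrix ι (Fin 3) ℝ} {B : Matrix (Fin 3) ι ℝ}

open Matrix

/-- The product of corresponding minors of order three of the stacked cross product matrices. -/
def crossMinorProd (A : Matrix ι (Fin 3) ℝ) (B : Matrix (Fin 3) ι ℝ) (p q r : ι × Fin 3) : ℝ :=
  ((crossRows A).submatrix ![p, q, r] id).det * ((crossRows Bᵀ).submatrix ![p, q, r] id).det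

theorem crossMinorProd_swap_left (p q r : ι × Fin 3) :
    crossMinorProd A B p q r = crossMinorProd A B q p r := by
  simp only [crossMinorProd, det_fin_three]
  simp
  ring

theorem crossMinorProd_swap_right (p q r : ι × Fin 3) :
    crossMinorProd A B p q r = crossMinorProd A B p r q := by
  simp only [crossMinorProd, det_fin_three]
  simp
  ring

/-- Two rows orthogonal to the basis vector e_c have a cross product along e_c, with a 2-minor of
columns c + 1, c + 2 as coefficient; the third row contributes its c-th component, which is ± an
entry or 0. -/
theorem crossMinorProd_nonneg_of_snd_eq (hAB : ∀ i j, 0 ≤ A i j * B j i)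
    (h4 : ∀ W : DSRClosedWalk A B 4, W.IsECycle → W.IsSCycle) (i₁ i₂ i₃ : ι) (c d : Fin 3) :
    0 ≤ crossMinorProd A B (i₁, c) (i₂, c) (i₃, d) := by
  have h := fun j => mul_nonneg (hAB i₃ j) (minor_two_mul_nonneg hAB h4 i₁ i₂ (c + 1) (c + 2))
  have h0 := h 0
  have h1 := h 1
  have h2 := h 2
  clear h
  fin_cases c <;> fin_cases d <;>
    simp only [crossMinorProd, det_fin_three] <;> simp [crossRows] at h0 h1 h2 ⊢ <;> linarith

/-- The zero diagonal leaves only the two 3-cycles in the determinant. -/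
theorem crossMinorProd_nonneg_of_distinct (hAB : ∀ i j, 0 ≤ A i j * B j i)
    (h4 : ∀ W : DSRClosedWalk A B 4, W.IsECycle → W.IsSCycle)
    (h6 : ∀ W : DSRClosedWalk A B 6, W.IsOCycle → W.IsSCycle) (i₁ i₂ i₃ : ι) :
    0 ≤ crossMinorProd A B (i₁, 0) (i₂, 1) (i₃, 2) := by
  have h := hexagon_mul_nonneg hAB h4 h6 i₁ i₂ i₃ (j₁ := 1) (j₂ := 2) (j₃ := 0)
    (by decide) (by decide) (by decide)
  simp only [crossMinorProd, det_fin_three]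
  simp [crossRows] at h ⊢
  linarith

theorem crossMinorProd_nonneg (hAB : ∀ i j, 0 ≤ A i j * B j i)
    (h4 : ∀ W : DSRClosedWalk A B 4, W.IsECycle → W.IsSCycle)
    (h6 : ∀ W : DSRClosedWalk A B 6, W.IsOCycle → W.IsSCycle) (p q r : ι × Fin 3) :
    0 ≤ crossMinorProd A B p q r := by
  obtain ⟨i₁, c₁⟩ := p
  obtain ⟨i₂, c₂⟩ := q
  obtain ⟨i₃, c₃⟩ := r
  rcases eq_or_ne c₁ c₂ with rfl | h₁₂
  · exact crossMinorProd_nonneg_of_snd_eq hAB h4 _ _ _ _ _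
  rcases eq_or_ne c₁ c₃ with rfl | h₁₃
  · rw [crossMinorProd_swap_right]
    exact crossMinorProd_nonneg_of_snd_eq hAB h4 _ _ _ _ _
  rcases eq_or_ne c₂ c₃ with rfl | h₂₃
  · rw [crossMinorProd_swap_left, crossMinorProd_swap_right]
    exact crossMinorProd_nonneg_of_snd_eq hAB h4 _ _ _ _ _
  have key := crossMinorProd_nonneg_of_distinct hAB h4 h6
  fin_cases c₁ <;> fin_cases c₂ <;> fin_cases c₃ <;> simp at h₁₂ h₁₃ h₂₃ ⊢
  · exact key _ _ _
  · rw [crossMinorProd_swap_right]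
    exact key _ _ _
  · rw [crossMinorProd_swap_left]
    exact key _ _ _
  · rw [crossMinorProd_swap_right, crossMinorProd_swap_left]
    exact key _ _ _
  · rw [crossMinorProd_swap_left, crossMinorProd_swap_right]
    exact key _ _ _
  · rw [crossMinorProd_swap_left, crossMinorProd_swap_right, crossMinorProd_swap_left]
    exact key _ _ _

theorem trace_mul_minorSum_sub_det_nonneg [Fintype ι] (hAB : ∀ i j, 0 ≤ A i j * B j i)
    (h4 : ∀ W : DSRClosedWalk A B 4, W.IsECycle → W.IsSCycle)
    (h6 : ∀ W : DSRClosedWalk A B 6, W.IsOCycle → W.IsSCycle) :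
    0 ≤ (B * A).trace * (B * A).minorSum - (B * A).det := by
  rw [← det_trace_smul_one_sub_transpose, ← transpose_crossRows_mul_crossRows]
  have h := factorial_mul_det_mul (crossRows Bᵀ)ᵀ (crossRows A)
  have hfact : (0 : ℝ) < ((Fintype.card (Fin 3)).factorial : ℝ) := by positivity
  refine nonneg_of_mul_nonneg_right (h.symm ▸ Finset.sum_nonneg fun f _ => ?_) hfact
  have hf : f = ![f 0, f 1, f 2] := by
    ext k <;> fin_cases k <;> rfl
  rw [← transpose_submatrix, det_transpose, mul_comm, hf]
  exact crossMinorProd_nonneg hAB h4 h6 _ _ _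

end CrossRows

/-! ### Transfer to the spectrum of `A * B` -/

theorem mainTheorem4 (m : ℕ) (C A : Matrix (Fin m) (Fin 3) ℝ) (B : Matrix (Fin 3) (Fin m) ℝ)
    (hA : A ∈ qualClass₀ C) (hB : Bᵀ ∈ qualClass₀ C)
    (h4 : ∀ W : DSRClosedWalk A B 4, W.IsECycle → W.IsSCycle)
    (h6 : ∀ W : DSRClosedWalk A B 6, W.IsOCycle → W.IsSCycle) :
    Disjoint (nonrealSpectrum (A * B)) openLeftHalfPlane := by
  rw [Set.disjoint_left]
  rintro z ⟨hz, him⟩ hre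
  have hz0 : z ≠ 0 := by
    rintro rfl
    exact him rfl
  have hmap {ι κ μ : Type} [Fintype κ] (X : Matrix ι κ ℝ) (Y : Matrix κ μ ℝ) :
      (X * Y).map Complex.ofReal = X.map Complex.ofReal * Y.map Complex.ofReal :=
    Matrix.map_mul (f := Complex.ofRealHom)
  rw [hmap] at hz
  have hdet := Matrix.mem_spectrum_mul_swap _ _ hz0 hz
  rw [← hmap, Matrix.det_smul_one_sub] at hdet
  refine not_le.2 hre (re_nonneg_of_cubic_root (trace_mul_minorSum_sub_det_nonneg
    (mul_nonneg_of_mem_qualClass₀ hA hB) h4 h6) him ?_)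
  rw [← hdet]
  simp [Matrix.minorSum, Matrix.trace_fin_three, Matrix.det_fin_three]
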